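/- Let $A$ be a finite abelian group of even order and exponent at least $3$, let $y\in A$ be an element of order $2$, and let $$\mathrm{Dic}(A,y)=\langle A,x \mid x^2=y,\ xax^{-1}=a^{-1}\ (a\in A)\rangle$$ be the associated generalized dicyclic group, so that $\mathrm{Dic}(A,y)=A\sqcup xA$. Let $S\subseteq \mathrm{Dic}(A,y)$ be such that $1\notin S$, $S^{-1}=S$ and $\langle S\rangle=\mathrm{Dic}(A,y)$. Write $S=S_1\cup xS_2$ with $S_1,S_2\subseteq A$, and assume $S_2^{-1}=S_2$. Let $\mathrm{Cay}(\mathrm{Dic}(A,y),S)$ be the graph with vertex set $\mathrm{Dic}(A,y)$ in which $g$ and $h$ are adjacent if and only if $g^{-1}h\in S$. Then $\mathrm{Cay}(\mathrm{Dic}(A,y),S)$ is distance integral (that is, it is connected and all eigenvalues of its distance matrix are integers) if and only if it is integral (that is, all eigenvalues of its adjacency matrix are integers). -/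

import Mathlib

open scoped Pointwise

universe u v

/-- The generalized dicyclic group `Dic(A, y)` of an abelian group `A` and an element `y` of
order two, written as the disjoint union `A ⊔ xA`: `base a` is the element `a` of `A` and
`coset a` is the product `x a`. The group structure, defined below, is where `orderOf y = 2`
is needed. -/
inductive Dic (A : Type u) (y : A) : Type u
  | base (a : A) : Dic A y
  | coset (a : A) : Dic A y

namespace Dic

section

variable {A : Type u} [CommGroup A] {y : A}

/-- The multiplication forced by `x ^ 2 = y` and `x a x⁻¹ = a⁻¹`:
`a (x b) = x (a⁻¹ b)` and `(x a) (x b) = x ^ 2 (a⁻¹ b) = y a⁻¹ b`. -/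
def mul : Dic A y → Dic A y → Dic A y
  | base a, base b => base (a * b)
  | base a, coset b => coset (a⁻¹ * b)
  | coset a, base b => coset (a * b)
  | coset a, coset b => base (y * (a⁻¹ * b))

/-- The inverse: `(x a)⁻¹ = x (y a)`. -/
def inv : Dic A y → Dic A y
  | base a => base a⁻¹
  | coset a => coset (y * a)

theorem y_mul_y (hy : orderOf y = 2) : y * y = 1 := by
  have h := pow_orderOf_eq_one y
  rw [hy, pow_two] at h
  exact h

theorem y_inv (hy : orderOf y = 2) : y⁻¹ = y :=
  inv_eq_of_mul_eq_one_right (y_mul_y hy)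

variable [hy : Fact (orderOf y = 2)]

instance instGroup : Group (Dic A y) where
  mul := mul
  one := base 1
  inv := inv
  mul_assoc := by
    rintro (a | a) (b | b) (c | c)
    · exact congrArg base (mul_assoc a b c)
    · exact congrArg coset (show (a * b)⁻¹ * c = a⁻¹ * (b⁻¹ * c) by
        rw [mul_inv, mul_assoc])
    · exact congrArg coset (mul_assoc a⁻¹ b c)
    · exact congrArg base (show y * ((a⁻¹ * b)⁻¹ * c) = a * (y * (b⁻¹ * c)) by
        rw [mul_inv, inv_inv, mul_assoc, mul_left_comm])
    · exact congrArg coset (mul_assoc a b c)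
    · exact congrArg base (show y * ((a * b)⁻¹ * c) = y * (a⁻¹ * (b⁻¹ * c)) by
        rw [mul_inv, mul_assoc])
    · exact congrArg base (show y * (a⁻¹ * b) * c = y * (a⁻¹ * (b * c)) by
        rw [mul_assoc, mul_assoc])
    · exact congrArg coset (show (y * (a⁻¹ * b))⁻¹ * c = a * (y * (b⁻¹ * c)) by
        rw [mul_inv, mul_inv, inv_inv, y_inv hy.out, mul_assoc, mul_assoc, mul_left_comm])
  one_mul := by
    rintro (a | a)
    · exact congrArg base (one_mul a)
    · exact congrArg coset (show (1 : A)⁻¹ * a = a by rw [inv_one, one_mul])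
  mul_one := by
    rintro (a | a)
    · exact congrArg base (mul_one a)
    · exact congrArg coset (mul_one a)
  inv_mul_cancel := by
    rintro (a | a)
    · exact congrArg base (inv_mul_cancel a)
    · exact congrArg base (show y * ((y * a)⁻¹ * a) = 1 by
        rw [mul_inv, mul_assoc, inv_mul_cancel, mul_one, mul_inv_cancel])

/-- The inclusion of `A` in `Dic(A, y)`. -/
def incl : A →* Dic A y where
  toFun := base
  map_one' := rfl
  map_mul' _ _ := rfl

/-- The distinguished generator `x` of `Dic(A, y)`. -/
def x : Dic A y := coset 1

/-- The underlying set of `Dic(A, y)` is the disjoint union of `A` and `xA`. -/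
def equivSum : A ⊕ A ≃ Dic A y where
  toFun := Sum.elim base coset
  invFun
    | base a => Sum.inl a
    | coset a => Sum.inr a
  left_inv := by rintro (a | a) <;> rfl
  right_inv := by rintro (a | a) <;> rfl

instance instFintype [Fintype A] : Fintype (Dic A y) :=
  Fintype.ofEquiv (A ⊕ A) equivSum

theorem x_mul_incl (a : A) : (x * incl a : Dic A y) = coset a :=
  congrArg coset (one_mul a)

theorem x_sq : (x : Dic A y) ^ 2 = incl y := by
  rw [pow_two]
  exact congrArg base (show y * ((1 : A)⁻¹ * 1) = y by simp)

theorem x_conj (a : A) : (x * incl a * x⁻¹ : Dic A y) = incl a⁻¹ := by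
  rw [mul_inv_eq_iff_eq_mul, x_mul_incl]
  exact congrArg coset (show a = (a⁻¹)⁻¹ * 1 by simp)

/-- The universal property of the presentation `⟨A, x | x ^ 2 = y, x a x⁻¹ = a⁻¹ (a ∈ A)⟩`,
which therefore presents the group constructed above. -/
theorem existsUnique_lift {G : Type v} [Group G] (f : A →* G) (g : G) (hg : g ^ 2 = f y)
    (hc : ∀ a, g * f a * g⁻¹ = f a⁻¹) :
    ∃! F : Dic A y →* G, (∀ a, F (incl a) = f a) ∧ F x = g := by
  have hc' : ∀ a, f a * g = g * f a⁻¹ := fun a => by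
    have h := hc a⁻¹
    rw [inv_inv, mul_inv_eq_iff_eq_mul] at h
    exact h.symm
  refine ⟨MonoidHom.mk' (fun z => match z with
    | base a => f a
    | coset a => g * f a) ?_, ⟨fun a => rfl, ?_⟩, ?_⟩
  · rintro (a | a) (b | b)
    · exact map_mul f a b
    · show g * f (a⁻¹ * b) = f a * (g * f b)
      rw [map_mul, ← mul_assoc, ← mul_assoc, hc' a]
    · show g * f (a * b) = g * f a * f b
      rw [map_mul, mul_assoc]
    · show f (y * (a⁻¹ * b)) = g * f a * (g * f b)
      rw [map_mul, map_mul, ← hg, pow_two, mul_assoc g (f a), ← mul_assoc (f a), hc' a]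
      simp only [mul_assoc]
  · show g * f 1 = g
    rw [map_one, mul_one]
  · rintro F ⟨h1, h2⟩
    ext z
    rcases z with a | a
    · exact h1 a
    · show F (coset a) = g * f a
      rw [← x_mul_incl, map_mul, h1, h2]

end

end Dic

namespace SimpleGraph

/-- All (complex) eigenvalues of the square matrix `M` are integers. -/
def HasIntegerEigenvalues {V : Type u} [Fintype V] (M : Matrix V V ℂ) : Prop :=
  open Classical in
  ∀ μ : ℂ, Module.End.HasEigenvalue (Matrix.toLin' M) μ → ∃ n : ℤ, μ = n

/-- A finite graph is integral if all eigenvalues of its adjacency matrix are integers. -/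
def IsIntegralGraph {V : Type u} [Fintype V] (Γ : SimpleGraph V) : Prop :=
  open Classical in
  HasIntegerEigenvalues (Γ.adjMatrix ℂ)

/-- The distance matrix of a graph, with zero diagonal. -/
noncomputable def distanceMatrix {V : Type u} (Γ : SimpleGraph V) : Matrix V V ℂ :=
  Matrix.of fun v w => (Γ.dist v w : ℂ)

/-- A finite graph is distance integral if it is connected and all eigenvalues of its distance
matrix are integers. -/
def IsDistanceIntegral {V : Type u} [Fintype V] (Γ : SimpleGraph V) : Prop :=
  Γ.Connected ∧ HasIntegerEigenvalues Γ.distanceMatrix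

end SimpleGraph

/-! Both matrices are convolution matrices of integer functions on `Dic A y`: the distance `ℓ` from
`1` and the indicator `δ` of `S`. Since `S⁻¹ = S` and `S₂⁻¹ = S₂`, both functions are invariant
under inversion and under `invEquiv`. Such matrices are diagonalized by the functions equal to `χ`
on `A` and `±χ⁻¹` on `xA`; the eigenvalues are character sums over `A`. By Galois theory these are
all integers exactly when the function is invariant under every `powEquiv`
(`hasIntegerEigenvalues_convMatrix_iff`). For `δ` this says that `powEquiv` preserves `S`; it is
then a graph automorphism fixing `1`, so it preserves `ℓ`. Conversely, `S` is the level set `ℓ = 1`.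
-/

open Polynomial in
/-- An integral polynomial expression in a primitive root of unity is an integer if and only if it
is invariant under the Galois action. -/
theorem IsPrimitiveRoot.aeval_eq_intCast_iff {n : ℕ} [NeZero n] {ζ : ℂ} (hζ : IsPrimitiveRoot ζ n)
    (P : ℤ[X]) :
    (∃ m : ℤ, aeval ζ P = m) ↔ ∀ k : ℕ, k.Coprime n → aeval (ζ ^ k) P = aeval ζ P := by
  constructor
  · rintro ⟨m, hm⟩ k hk
    have hdvd : minpoly ℤ ζ ∣ P - C m :=
      minpoly.isIntegrallyClosed_dvd (hζ.isIntegral (NeZero.pos n)) (by simp [hm])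
    -- Conjugate roots of unity share a minimal polynomial, so `ζ ^ k` is also a root of `P - m`.
    rw [hζ.minpoly_eq_pow_coprime hk] at hdvd
    have h0 : aeval (ζ ^ k) (P - C m) = 0 := by
      obtain ⟨Q, hQ⟩ := hdvd
      rw [hQ, map_mul, minpoly.aeval, zero_mul]
    rw [hm]
    simpa [sub_eq_zero] using h0
  · intro h
    let K := CyclotomicField n ℚ
    have : IsCyclotomicExtension {n} ℚ K := CyclotomicField.isCyclotomicExtension n ℚ
    have : IsGalois ℚ K := IsCyclotomicExtension.isGalois {n} ℚ K
    have : FiniteDimensional ℚ K := IsCyclotomicExtension.finiteDimensional {n} ℚ K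
    have hz : IsPrimitiveRoot (IsCyclotomicExtension.zeta n ℚ K) n :=
      IsCyclotomicExtension.zeta_spec n ℚ K
    set z := IsCyclotomicExtension.zeta n ℚ K
    let φ : K →ₐ[ℚ] ℂ := IsAlgClosed.lift
    have hφ (t : K) : φ (aeval t P) = aeval (φ t) P :=
      (aeval_algHom_apply (φ.restrictScalars ℤ) t P).symm
    -- The embedding need not send `z` to `ζ`, only to some `ζ ^ j` with `j` coprime to `n`.
    obtain ⟨j, -, hj, hjz⟩ := hζ.isPrimitiveRoot_iff.1 (hz.map_of_injective φ.injective)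
    have hfix : ∀ σ : Gal(K/ℚ), σ (aeval z P) = aeval z P := by
      intro σ
      obtain ⟨k, -, hk, hkz⟩ := hz.isPrimitiveRoot_iff.1 (hz.map_of_injective σ.injective)
      have h1 : σ (aeval z P) = aeval (σ z) P :=
        (aeval_algHom_apply (σ.toAlgHom.restrictScalars ℤ) z P).symm
      refine φ.injective (?_ : φ _ = φ _)
      rw [h1, hφ, hφ, ← show z ^ k = σ z from hkz, map_pow, ← show ζ ^ j = φ z from hjz, ← pow_mul, h _ (hj.mul_left hk), h j hj]
    obtain ⟨q, hq⟩ := IntermediateField.mem_bot.1 ((IsGalois.mem_bot_iff_fixed _).2 hfix)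
    -- The value is rational by Galois descent; being an algebraic integer, it is an integer.
    have hint : IsIntegral ℤ (aeval z P) := by
      rw [aeval_eq_sum_range]
      exact IsIntegral.sum _ fun i _ => ((hz.isIntegral (NeZero.pos n)).pow i).smul _
    rw [← hq, isIntegral_algebraMap_iff (algebraMap ℚ K).injective,
      IsIntegrallyClosed.isIntegral_iff] at hint
    obtain ⟨m, hm⟩ := hint
    refine ⟨m, ?_⟩
    rw [← h j hj, show ζ ^ j = φ z from hjz, ← hφ, ← hq, ← hm]
    simp

/-! ### Fourier analysis on finite abelian groups -/

section Characters

variable {A : Type*} [CommGroup A] [Fintype A]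

/-- The characters of a finite abelian group separate its functions. -/
theorem eq_zero_of_forall_sum_mul_character_eq_zero (v : A → ℂ)
    (h : ∀ χ : A →* ℂ, ∑ a, v a * χ a = 0) : v = 0 := by
  classical
  funext b
  -- Fourier inversion at `b`: by orthogonality of characters only the term `a = b` survives.
  have key : ∑ ψ : AddChar (Additive A) ℂ, ψ (-Additive.ofMul b) *
      ∑ a : Additive A, v a.toMul * ψ a = 0 := by
    refine Finset.sum_eq_zero fun ψ _ => ?_
    have := h ⟨⟨fun a => ψ (Additive.ofMul a), ψ.map_zero_eq_one⟩,
      fun a b => ψ.map_add_eq_mul (Additive.ofMul a) (Additive.ofMul b)⟩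
    rw [← Equiv.sum_comp Additive.ofMul]
    exact mul_eq_zero_of_right _ this
  simp_rw [Finset.mul_sum] at key
  rw [Finset.sum_comm] at key
  have h2 : ∀ a : Additive A, ∑ ψ : AddChar (Additive A) ℂ, ψ (-Additive.ofMul b) *
      (v a.toMul * ψ a) = v a.toMul * if a = Additive.ofMul b then (Fintype.card A : ℂ) else 0 := by
    intro a
    have := AddChar.sum_apply_eq_ite (a - Additive.ofMul b)
    simp only [sub_eq_zero, Fintype.card_additive] at this
    rw [← this, Finset.mul_sum]
    refine Finset.sum_congr rfl fun ψ _ => ?_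
    rw [sub_eq_add_neg, AddChar.map_add_eq_mul]
    ring
  simp_rw [h2] at key
  simpa using key

open Polynomial in
/-- The Fourier transform of an integer-valued function on a finite abelian group is
integer-valued if and only if the function is invariant under all power automorphisms. -/
theorem forall_character_sum_eq_intCast_iff (w : A → ℤ) :
    (∀ χ : A →* ℂ, ∃ m : ℤ, ∑ a, (w a : ℂ) * χ a = m) ↔
      ∀ k : ℕ, k.Coprime (Nat.card A) → ∀ a, w (a ^ k) = w a := by
  have hn : NeZero (Nat.card A) := ⟨Nat.card_pos.ne'⟩
  obtain ⟨ζ, hζ⟩ : ∃ ζ : ℂ, IsPrimitiveRoot ζ (Nat.card A) :=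
    ⟨_, Complex.isPrimitiveRoot_exp _ hn.out⟩
  have hpoly (χ : A →* ℂ) : ∃ P : ℤ[X], ∀ k : ℕ,
      aeval (ζ ^ k) P = ∑ a, (w a : ℂ) * χ (a ^ k) := by
    have hχ (a : A) : ∃ i, ζ ^ i = χ a := by
      obtain ⟨i, -, hi⟩ := hζ.eq_pow_of_pow_eq_one (ξ := χ a) (by
        rw [← map_pow, pow_card_eq_one', map_one])
      exact ⟨i, hi⟩
    choose e he using hχ
    refine ⟨∑ a, C (w a) * X ^ e a, fun k => ?_⟩
    rw [map_sum]
    refine Finset.sum_congr rfl fun a _ => ?_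
    rw [map_pow, ← he, map_mul, map_pow, aeval_X, aeval_C, ← pow_mul, ← pow_mul, mul_comm k]
    rfl
  have hcrit (χ : A →* ℂ) : (∃ m : ℤ, ∑ a, (w a : ℂ) * χ a = m) ↔
      ∀ k : ℕ, k.Coprime (Nat.card A) →
        ∑ a, (w a : ℂ) * χ (a ^ k) = ∑ a, (w a : ℂ) * χ a := by
    obtain ⟨P, hP⟩ := hpoly χ
    have h1 := hP 1
    simp only [pow_one] at h1
    simp only [← h1, ← hP]
    exact hζ.aeval_eq_intCast_iff P
  simp_rw [hcrit]
  constructor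
  · intro h k hk
    let e : A ≃ A := powCoprime hk.symm
    -- Reindexing by `e` turns the transform of `w ∘ e.symm` into the Galois conjugate `∑ a, w a * χ
    -- (a ^ k)` of that of `w`.
    have hv : (fun b => (w b : ℂ) - w (e.symm b)) = 0 := by
      refine eq_zero_of_forall_sum_mul_character_eq_zero _ fun χ => ?_
      simp_rw [sub_mul, Finset.sum_sub_distrib]
      rw [← h χ k hk, sub_eq_zero, ← Equiv.sum_comp e fun b => (w (e.symm b) : ℂ) * χ b]
      simp only [Equiv.symm_apply_apply]
      rfl
    intro a
    have := congrFun hv (e a)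
    simp only [Equiv.symm_apply_apply, Pi.zero_apply, sub_eq_zero] at this
    exact_mod_cast this
  · intro h χ k hk
    let e : A ≃ A := powCoprime hk.symm
    rw [← Equiv.sum_comp e fun b => (w b : ℂ) * χ b]
    refine Finset.sum_congr rfl fun a _ => ?_
    rw [show e a = a ^ k from rfl, h k hk]

end Characters

/-! ### Distances and automorphisms of Cayley graphs -/

namespace SimpleGraph

theorem dist_le_of_hom {V W : Type*} {G : SimpleGraph V} {H : SimpleGraph W} (hG : G.Connected)
    (f : G →g H) (u v : V) : H.dist (f u) (f v) ≤ G.dist u v := by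
  obtain ⟨p, hp⟩ := hG.exists_walk_length_eq_dist u v
  rw [← hp, ← p.length_map f]
  exact dist_le _

theorem dist_iso_apply {V : Type*} {G : SimpleGraph V} (hG : G.Connected) (f : G ≃g G) (u v : V) :
    G.dist (f u) (f v) = G.dist u v := by
  refine le_antisymm (dist_le_of_hom hG f.toHom u v) ?_
  simpa using dist_le_of_hom hG f.symm.toHom (f u) (f v)

section Cayley

variable {G : Type*} [Group G] {S : Set G}

theorem mulCayley_connected (h : Subgroup.closure S = ⊤) : (mulCayley S).Connected := by
  have hstep (g s : G) (hs : s ∈ S) : (mulCayley S).Reachable g (g * s) := by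
    by_cases hg : g = g * s
    · rw [← hg]
    · exact ((mulCayley_adj S _ _).2 ⟨hg, Or.inl (by simpa using hs)⟩).reachable
  have h1 (g : G) : (mulCayley S).Reachable 1 g := by
    have hg : g ∈ Subgroup.closure S := h ▸ Subgroup.mem_top g
    induction hg using Subgroup.closure_induction_right with
    | one => exact Reachable.refl 1
    | mul_right x hx s hs ih => exact ih.trans (hstep x s hs)
    | mul_inv_cancel x hx s hs ih =>
      exact ih.trans (by simpa using (hstep (x * s⁻¹) s hs).symm)
  exact (connected_iff _).2 ⟨fun a b => (h1 a).symm.trans (h1 b), ⟨1⟩⟩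

theorem mulCayley_adj_iff_of_inv_eq (h_one : (1 : G) ∉ S) (h_inv : S⁻¹ = S) (g h : G) :
    (mulCayley S).Adj g h ↔ g⁻¹ * h ∈ S := by
  rw [mulCayley_adj]
  have hinv : h⁻¹ * g ∈ S ↔ g⁻¹ * h ∈ S := by
    conv_lhs => rw [← h_inv, Set.mem_inv, mul_inv_rev, inv_inv]
  rw [hinv, or_self, and_iff_right_iff_imp]
  rintro hS rfl
  exact h_one (by simpa using hS)

/-- Left translations are automorphisms of Cayley graphs. -/
def mulCayleyLeftMul (S : Set G) (g : G) : mulCayley S ≃g mulCayley S where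
  toEquiv := Equiv.mulLeft g
  map_rel_iff' := mulCayley_adj_mul_iff_right

/-- A group automorphism preserving the connection set is an automorphism of the Cayley graph. -/
def mulCayleyMulEquiv (e : G ≃* G) (he : ∀ g, e g ∈ S ↔ g ∈ S) : mulCayley S ≃g mulCayley S where
  toEquiv := e.toEquiv
  map_rel_iff' := by
    intro g h
    simp only [mulCayley_adj, MulEquiv.toEquiv_eq_coe, EquivLike.coe_coe, ← map_inv, ← map_mul, he,
      ne_eq, EmbeddingLike.apply_eq_iff_eq]

theorem mulCayley_dist_eq (hc : (mulCayley S).Connected) (g h : G) :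
    (mulCayley S).dist g h = (mulCayley S).dist 1 (g⁻¹ * h) := by
  rw [← dist_iso_apply hc (mulCayleyLeftMul S g⁻¹) g h]
  rw [show mulCayleyLeftMul S g⁻¹ g = 1 from inv_mul_cancel g]
  rfl

end Cayley

end SimpleGraph

/-! ### Spectra of convolution matrices on `Dic A y` -/

namespace Dic

theorem sum_eq {A : Type*} [Fintype A] {y : A} {M : Type*} [AddCommMonoid M] (F : Dic A y → M) :
    ∑ g, F g = ∑ a, F (base a) + ∑ a, F (coset a) := by
  rw [← Equiv.sum_comp equivSum, Fintype.sum_sum_type]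
  rfl

section Eigenfunction

variable {A : Type u} [CommGroup A] {y : A}

/-- The function on `Dic(A, y)` which is `χ` on `A` and `ε χ⁻¹` on `xA`. -/
def eigenfunction (y : A) (χ : A →* ℂ) (ε : ℤ) : Dic A y → ℂ
  | base a => χ a
  | coset a => ε * χ a⁻¹

theorem eigenfunction_ne_zero (χ : A →* ℂ) (ε : ℤ) : eigenfunction y χ ε ≠ 0 := fun h => by
  have := congrFun h (base 1)
  simp [eigenfunction] at this

/-- Completeness of the eigenfunctions: adding and subtracting the cases `ε = 1` and `ε = -1`
isolates the two halves of `v`, and characters separate each half. -/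
theorem eq_zero_of_forall_dotProduct_eigenfunction_eq_zero [Fintype A] (v : Dic A y → ℂ)
    (h : ∀ χ : A →* ℂ, ∀ ε : ℤ, ε * ε = 1 → v ⬝ᵥ eigenfunction y χ ε = 0) : v = 0 := by
  have key (χ : A →* ℂ) (ε : ℤ) (hε : ε * ε = 1) :
      ∑ a, v (base a) * χ a + ε * ∑ a, v (coset a) * χ a⁻¹ = 0 := by
    rw [← h χ ε hε, dotProduct, sum_eq, Finset.mul_sum]
    refine congrArg₂ _ rfl (Finset.sum_congr rfl fun a _ => ?_)
    exact mul_left_comm _ _ _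
  have hp (χ : A →* ℂ) := key χ 1 rfl
  have hm (χ : A →* ℂ) := key χ (-1) rfl
  push_cast at hp hm
  have hb : (fun a => v (base a)) = 0 := eq_zero_of_forall_sum_mul_character_eq_zero _ fun χ => by
    linear_combination (hp χ + hm χ) / 2
  have hc : (fun a => v (coset a⁻¹)) = 0 :=
    eq_zero_of_forall_sum_mul_character_eq_zero _ fun χ => by
      rw [← Equiv.sum_comp (Equiv.inv A)]
      simp only [Equiv.inv_apply, inv_inv]
      linear_combination (hp χ - hm χ) / 2
  funext g
  rcases g with a | a
  · exact congrFun hb a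
  · simpa using congrFun hc a⁻¹

end Eigenfunction

variable {A : Type u} [CommGroup A] {y : A} [hy : Fact (orderOf y = 2)]

@[simp] theorem base_mul_base (a b : A) : (base a * base b : Dic A y) = base (a * b) := rfl

@[simp] theorem base_mul_coset (a b : A) :
    (base a * coset b : Dic A y) = coset (a⁻¹ * b) := rfl

@[simp] theorem coset_mul_base (a b : A) : (coset a * base b : Dic A y) = coset (a * b) := rfl

@[simp] theorem coset_mul_coset (a b : A) :
    (coset a * coset b : Dic A y) = base (y * (a⁻¹ * b)) := rfl

@[simp] theorem inv_base (a : A) : (base a : Dic A y)⁻¹ = base a⁻¹ := rfl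

@[simp] theorem inv_coset (a : A) : (coset a : Dic A y)⁻¹ = coset (y * a) := rfl

/-- The automorphism of `Dic(A, y)` which inverts `A` and fixes `x`. -/
def invEquiv : Dic A y ≃* Dic A y where
  toFun
    | base a => base a⁻¹
    | coset a => coset a⁻¹
  invFun
    | base a => base a⁻¹
    | coset a => coset a⁻¹
  left_inv := by rintro (a | a) <;> simp
  right_inv := by rintro (a | a) <;> simp
  map_mul' := by rintro (a | a) (b | b) <;> simp [mul_comm, y_inv hy.out]

/-- Oddness of `k` gives `y ^ k = y`, which makes the power map on both halves multiplicative. -/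
theorem odd_of_coprime_card {A : Type*} [Group A] {y : A} (hy : orderOf y = 2) {k : ℕ} (hk : k.Coprime (Nat.card A)) : Odd k := by
  have h2 : 2 ∣ Nat.card A := hy ▸ orderOf_dvd_natCard y
  exact (Nat.coprime_two_right).1 (hk.coprime_dvd_right h2)

/-- The automorphism of `Dic(A, y)` which raises the elements of `A` to a power coprime to the
order of `A` and fixes `x`. -/
noncomputable def powEquiv [Fintype A] {k : ℕ} (hk : k.Coprime (Nat.card A)) :
    Dic A y ≃* Dic A y where
  toEquiv := equivSum.symm.trans
    (((powCoprime hk.symm).sumCongr (powCoprime hk.symm)).trans equivSum)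
  map_mul' := by
    have hyk : y ^ k = y := by
      obtain ⟨m, rfl⟩ := odd_of_coprime_card hy.out hk
      rw [pow_succ, pow_mul, pow_two, y_mul_y hy.out, one_pow, one_mul]
    rintro (a | a) (b | b)
    · exact congrArg base (mul_pow a b k)
    · exact congrArg coset (show (a⁻¹ * b) ^ k = (a ^ k)⁻¹ * b ^ k by rw [mul_pow, inv_pow])
    · exact congrArg coset (mul_pow a b k)
    · exact congrArg base (show (y * (a⁻¹ * b)) ^ k = y * ((a ^ k)⁻¹ * b ^ k) by
        rw [mul_pow, mul_pow, inv_pow, hyk])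

@[simp] theorem powEquiv_base [Fintype A] {k : ℕ} (hk : k.Coprime (Nat.card A)) (a : A) :
    powEquiv hk (base a : Dic A y) = base (a ^ k) := rfl

@[simp] theorem powEquiv_coset [Fintype A] {k : ℕ} (hk : k.Coprime (Nat.card A)) (a : A) :
    powEquiv hk (coset a : Dic A y) = coset (a ^ k) := rfl

/-- The convolution matrix of a function on `Dic(A, y)`. -/
def convMatrix (f : Dic A y → ℤ) : Matrix (Dic A y) (Dic A y) ℂ :=
  Matrix.of fun g h => (f (g⁻¹ * h) : ℂ)

theorem convMatrix_transpose {f : Dic A y → ℤ} (hfi : ∀ g, f g⁻¹ = f g) :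
    (convMatrix f).transpose = convMatrix f := by
  ext g h
  simp only [convMatrix, Matrix.transpose_apply, Matrix.of_apply]
  rw [← hfi (h⁻¹ * g), mul_inv_rev, inv_inv]

section Spectrum

variable [Fintype A]

/-- Translating the summation variable factors out the value at `g`. The terms mixing `A` and `xA`
also need `a ↦ a⁻¹`, absorbed by `hf`; `hfi` removes the factor `y` coming from `(x a)⁻¹ = x (y a)`.
-/
theorem convMatrix_mulVec_eigenfunction {f : Dic A y → ℤ} (hf : ∀ g, f (invEquiv g) = f g)
    (hfi : ∀ g, f g⁻¹ = f g) (χ : A →* ℂ) {ε : ℤ} (hε : ε * ε = 1) :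
    (convMatrix f).mulVec (eigenfunction y χ ε) =
      (∑ a, ((f (base a) + ε * f (coset a) : ℤ) : ℂ) * χ a) • eigenfunction y χ ε := by
  have hε' : (ε : ℂ) * ε = 1 := by exact_mod_cast hε
  have h1 (a : A) : f (base a⁻¹) = f (base a) := hf (base a)
  have h2 (a : A) : f (coset a⁻¹) = f (coset a) := hf (coset a)
  have h3 (a : A) : f (coset (y * a)) = f (coset a) := hfi (coset a)
  funext g
  simp only [Matrix.mulVec, dotProduct, sum_eq, convMatrix, Matrix.of_apply, Pi.smul_apply,
    smul_eq_mul, Int.cast_add, Int.cast_mul, add_mul, Finset.sum_add_distrib, Finset.sum_mul]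
  rcases g with b | b
  · congr 1
    · rw [← Equiv.sum_comp (Equiv.mulLeft b)]
      refine Finset.sum_congr rfl fun a _ => ?_
      simp only [Equiv.coe_mulLeft, eigenfunction, inv_base, base_mul_base, inv_mul_cancel_left,
        map_mul]
      ring
    · rw [← Equiv.sum_comp ((Equiv.inv A).trans (Equiv.mulLeft b⁻¹))]
      refine Finset.sum_congr rfl fun a _ => ?_
      simp [eigenfunction, mul_assoc, mul_comm, mul_left_comm, h2]
  -- On a row in `xA` the two halves trade roles: the sum over `xA` sees `f` on `A`, and the sum
  -- over `A` sees `f` on `xA`, where `ε ^ 2 = 1` restores the factor `ε`.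
  · rw [add_comm]
    congr 1
    · rw [← Equiv.sum_comp ((Equiv.inv A).trans (Equiv.mulLeft b))]
      refine Finset.sum_congr rfl fun a _ => ?_
      have : y * (y * (b⁻¹ * (b * a⁻¹))) = a⁻¹ := by
        rw [← mul_assoc, y_mul_y hy.out]; simp
      simp only [Equiv.trans_apply, Equiv.inv_apply, Equiv.coe_mulLeft, eigenfunction, inv_coset,
        coset_mul_coset, mul_inv, y_inv hy.out, inv_inv, map_mul, mul_assoc, this, h1]
      ring
    · rw [← Equiv.sum_comp (Equiv.mulLeft b⁻¹)]
      refine Finset.sum_congr rfl fun a _ => ?_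
      simp only [Equiv.coe_mulLeft, eigenfunction, inv_coset, coset_mul_base, map_mul, mul_assoc,
        mul_inv_cancel_left, h3]
      linear_combination (-(f (coset a) : ℂ) * χ a * χ b⁻¹) * hε'

theorem hasIntegerEigenvalues_convMatrix_iff_forall_character {f : Dic A y → ℤ}
    (hf : ∀ g, f (invEquiv g) = f g) (hfi : ∀ g, f g⁻¹ = f g) :
    SimpleGraph.HasIntegerEigenvalues (convMatrix f) ↔ ∀ ε : ℤ, ε * ε = 1 → ∀ χ : A →* ℂ,
      ∃ m : ℤ, ∑ a, ((f (base a) + ε * f (coset a) : ℤ) : ℂ) * χ a = m := by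
  classical
  constructor
  · intro h ε hε χ
    refine h _ (Module.End.hasEigenvalue_of_hasEigenvector (x := eigenfunction y χ ε)
      ⟨Module.End.mem_eigenspace_iff.2 ?_, eigenfunction_ne_zero χ ε⟩)
    rw [← convMatrix_mulVec_eigenfunction hf hfi χ hε]
    convert Matrix.toLin'_apply _ _
  · intro h μ hμ
    obtain ⟨v, hv⟩ := hμ.exists_hasEigenvector
    have hvμ : (convMatrix f).mulVec v = μ • v := by
      rw [← hv.apply_eq_smul]
      convert (Matrix.toLin'_apply _ _).symm
    by_contra hne
    -- The matrix is symmetric, so an eigenvector `v` with non-integer eigenvalue has zero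
    -- (bilinear) product with every eigenfunction, whose eigenvalue is an integer.
    refine hv.2 (eq_zero_of_forall_dotProduct_eigenfunction_eq_zero v fun χ ε hε => ?_)
    obtain ⟨m, hm⟩ := h ε hε χ
    have h1 := Matrix.dotProduct_mulVec v (convMatrix f) (eigenfunction y χ ε)
    rw [convMatrix_mulVec_eigenfunction hf hfi χ hε, hm, ← Matrix.mulVec_transpose,
      convMatrix_transpose hfi, hvμ, dotProduct_smul, smul_dotProduct, smul_eq_mul,
      smul_eq_mul] at h1
    by_contra h0
    exact hne ⟨m, (mul_right_cancel₀ h0 h1).symm⟩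

/-- The convolution matrix of a suitably symmetric integer-valued function on `Dic(A, y)` has only
integer eigenvalues if and only if the function is invariant under all power automorphisms. -/
theorem hasIntegerEigenvalues_convMatrix_iff {f : Dic A y → ℤ}
    (hf : ∀ g, f (invEquiv g) = f g) (hfi : ∀ g, f g⁻¹ = f g) :
    SimpleGraph.HasIntegerEigenvalues (convMatrix f) ↔
      ∀ (k : ℕ) (hk : k.Coprime (Nat.card A)) (g : Dic A y), f (powEquiv hk g) = f g := by
  rw [hasIntegerEigenvalues_convMatrix_iff_forall_character hf hfi]
  simp_rw [fun ε => forall_character_sum_eq_intCast_iff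
    fun a => f (base a : Dic A y) + ε * f (coset a)]
  constructor
  · intro h k hk g
    rcases g with a | a
    -- Invariance of both the sum and the difference of the two halves gives that of each half.
    · have hp := h 1 rfl k hk a
      have hm := h (-1) rfl k hk a
      simp only [powEquiv_base]
      omega
    · have hp := h 1 rfl k hk a
      have hm := h (-1) rfl k hk a
      simp only [powEquiv_coset]
      omega
  · intro h ε _ k hk a
    have h1 := h k hk (base a)
    have h2 := h k hk (coset a)
    rw [powEquiv_base] at h1
    rw [powEquiv_coset] at h2
    rw [h1, h2]

end Spectrum

end Dic

/-! ### The equivalence for Cayley graphs -/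

theorem theorem6p1 {A : Type*} [CommGroup A] [Fintype A] (hA : 3 ≤ Monoid.exponent A)
    (y : A) [Fact (orderOf y = 2)]
    (S : Set (Dic A y)) (h_one : (1 : Dic A y) ∉ S) (h_inv : S⁻¹ = S)
    (h_gen : Subgroup.closure S = ⊤)
    (S₁ S₂ : Set A)
    (h_split : S = Dic.incl '' S₁ ∪ (fun a => Dic.x * Dic.incl a) '' S₂)
    (h_inv₂ : S₂⁻¹ = S₂) :
    (SimpleGraph.mulCayley S).IsDistanceIntegral ↔
      (SimpleGraph.mulCayley S).IsIntegralGraph := by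
  classical
  have hc := SimpleGraph.mulCayley_connected h_gen
  have hSi (g : Dic A y) : g⁻¹ ∈ S ↔ g ∈ S := by rw [← Set.mem_inv, h_inv]
  have hcoset (a : A) : (Dic.coset a : Dic A y) ∈ S ↔ a ∈ S₂ := by
    simp_rw [h_split, Dic.x_mul_incl]
    simp [Dic.incl]
  -- On `A` this is `S⁻¹ = S`; on `xA` it is exactly `S₂⁻¹ = S₂`.
  have hS (g : Dic A y) : Dic.invEquiv g ∈ S ↔ g ∈ S := by
    rcases g with a | a
    · exact hSi (Dic.base a)
    · change (Dic.coset a⁻¹ : Dic A y) ∈ S ↔ _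
      rw [hcoset, hcoset, ← Set.mem_inv, h_inv₂]
  let ℓ : Dic A y → ℤ := fun g => (SimpleGraph.mulCayley S).dist 1 g
  let δ : Dic A y → ℤ := fun g => if g ∈ S then 1 else 0
  have hℓ (e : Dic A y ≃* Dic A y) (he : ∀ g, e g ∈ S ↔ g ∈ S) (g : Dic A y) :
      ℓ (e g) = ℓ g := by
    have := SimpleGraph.dist_iso_apply hc (SimpleGraph.mulCayleyMulEquiv e he) 1 g
    rw [show SimpleGraph.mulCayleyMulEquiv e he 1 = 1 from map_one e] at this
    exact congrArg Nat.cast this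
  have hℓi (g : Dic A y) : ℓ g⁻¹ = ℓ g := by
    have := SimpleGraph.mulCayley_dist_eq hc g 1
    rw [mul_one, SimpleGraph.dist_comm] at this
    exact congrArg Nat.cast this.symm
  have hℓS (g : Dic A y) : ℓ g = 1 ↔ g ∈ S := by
    have : ℓ g = 1 ↔ (SimpleGraph.mulCayley S).dist 1 g = 1 := Nat.cast_eq_one
    rw [this, SimpleGraph.dist_eq_one_iff_adj, SimpleGraph.mulCayley_adj_iff_of_inv_eq h_one h_inv,
      inv_one, one_mul]
  have hD : (SimpleGraph.mulCayley S).distanceMatrix = Dic.convMatrix ℓ := by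
    ext g h
    simp [SimpleGraph.distanceMatrix, Dic.convMatrix, ℓ, SimpleGraph.mulCayley_dist_eq hc g h]
  have hM : (SimpleGraph.mulCayley S).adjMatrix ℂ = Dic.convMatrix δ := by
    ext g h
    simp [SimpleGraph.adjMatrix_apply, Dic.convMatrix, δ,
      SimpleGraph.mulCayley_adj_iff_of_inv_eq h_one h_inv]
  have hint : (SimpleGraph.mulCayley S).IsIntegralGraph ↔
      SimpleGraph.HasIntegerEigenvalues (Dic.convMatrix δ) := by
    rw [← hM, SimpleGraph.IsIntegralGraph]
    convert Iff.rfl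
  rw [SimpleGraph.IsDistanceIntegral, and_iff_right hc, hint, hD,
    Dic.hasIntegerEigenvalues_convMatrix_iff (hℓ _ hS) hℓi,
    Dic.hasIntegerEigenvalues_convMatrix_iff (by simp [δ, hS]) (by simp [δ, hSi])]
  have hδ (g h : Dic A y) : δ g = δ h ↔ (g ∈ S ↔ h ∈ S) := by
    by_cases hg : g ∈ S <;> by_cases hh : h ∈ S <;> simp [δ, hg, hh]
  refine forall₂_congr fun k hk => ?_
  simp_rw [hδ]
  -- Invariance of `ℓ` restricts to its level set `S`; an automorphism preserving `S` preserves `ℓ`.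
  exact ⟨fun h g => by rw [← hℓS, ← hℓS, h], fun h => hℓ _ h⟩
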